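/- Let $\varepsilon>0$ be real and let $k,c\ge 1$ be integers. Write $[r]=\{0,\dots,r-1\}$. For a finite set $U$ and $\kappa\ge 2$, a nonempty set $\mathcal H$ of functions $U\to[r]$ is called $\kappa$-wise independent if for all distinct $x_1,\dots,x_\kappa\in U$ and all $y_1,\dots,y_\kappa\in[r]$, a uniformly random $h\in\mathcal H$ satisfies $\Pr(h(x_1)=y_1\wedge\dots\wedge h(x_\kappa)=y_\kappa)=r^{-\kappa}$. Let $U$ be a finite set, let $S\subseteq U$ with $|S|=n$, and let $m,\ell\ge 1$ be integers with $m\ge(1+\varepsilon)n$ (in particular, $m=(1+\varepsilon)n$ is allowed). Let $\mathcal H_m$ and $\mathcal H_\ell$ be $2k$-wise independent sets of functions $U\to[m]$ and $U\to[\ell]$, respectively. Choose $f_1,f_2\in\mathcal H_m$, $g_1,\dots,g_c\in\mathcal H_\ell$ and vectors $z^{(i)}_j\in[m]^\ell$ ($i\in\{1,2\}$, $1\le j\le c$) uniformly and independently at random, and put $$h_i(x)=\Bigl(f_i(x)+\sum_{j=1}^{c} z^{(i)}_j[g_j(x)]\Bigr)\bmod m\qquad (x\in U,\ i\in\{1,2\}).$$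 For $T\subseteq U$ let $G(T,h_1,h_2)$ be the bipartite multigraph whose two vertex sets are disjoint copies of $[m]$ and which has, for each $x\in T$, one edge joining $h_1(x)$ in the first copy to $h_2(x)$ in the second copy. Call a multigraph leafless if it has no vertex of degree $1$. Call the random choice $T$-bad if $|T|-\max\{k,|g_1(T)|,\dots,|g_c(T)|\}>k$. Then $$\Pr\bigl(\exists\,T\subseteq S:\ G(T,h_1,h_2)\text{ is leafless and }(h_1,h_2)\text{ is }T\text{-bad}\bigr)\ \le\ C\cdot\frac{n}{\ell^{ck}},$$ where the constant $C>0$ depends only on $\varepsilon$, $k$ and $c$ (and not on $U$, $S$, $n$, $m$, $\ell$ or the hash families). -/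

import Mathlib

namespace CuckooHash

/-- Probability of the event `E` when an element is drawn uniformly at random from the
(nonempty) set `A` of elements of a finite type. -/
noncomputable def uniformProb {Ω : Type*} [Finite Ω] (A E : Set Ω) : ℝ :=
  ((A ∩ E).ncard : ℝ) / (A.ncard : ℝ)

/-- A nonempty set `H` of hash functions `U → [r]` is a `κ`-wise independent hash family:
for distinct keys `x 0, …, x (κ - 1)` and arbitrary values `y 0, …, y (κ - 1)` in `[r]`, the
probability over uniform `h ∈ H` that `h (x i) = y i` for all `i` is `1 / r ^ κ`. -/
def IsWiseIndependent {U : Type*} [Finite U] {r : ℕ} (κ : ℕ) (H : Set (U → Fin r)) : Prop :=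
  H.Nonempty ∧
    ∀ x : Fin κ → U, Function.Injective x → ∀ y : Fin κ → Fin r,
      uniformProb H {h | ∀ i, h (x i) = y i} = 1 / (r : ℝ) ^ κ

/-- The components `f_i`, `g_j`, `z^{(i)}_j` (`i` one of two indices, `j` one of `c` indices)
from which a pair of hash functions `U → [m]` is built. -/
structure HashPair (U : Type*) (m ℓ c : ℕ) where
  /-- the functions `f_1, f_2` -/
  f : Fin 2 → U → Fin m
  /-- the functions `g_1, …, g_c` -/
  g : Fin c → U → Fin ℓ
  /-- the tables `z^{(i)}_j ∈ [m]^ℓ` -/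
  z : Fin 2 → Fin c → Fin ℓ → Fin m

instance {U : Type*} [Finite U] {m ℓ c : ℕ} : Finite (HashPair U m ℓ c) :=
  Finite.of_injective (fun w => (w.f, w.g, w.z)) (by
    rintro ⟨f, g, z⟩ ⟨f', g', z'⟩ h
    simp only [Prod.mk.injEq] at h
    obtain ⟨rfl, rfl, rfl⟩ := h
    rfl)

/-- The hash functions `h_i(x) = (f_i(x) + ∑_j z^{(i)}_j[g_j(x)]) mod m`
(addition in `Fin m` is addition modulo `m`). -/
def HashPair.hash {U : Type*} {m ℓ c : ℕ} [NeZero m] (w : HashPair U m ℓ c)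
    (i : Fin 2) (x : U) : Fin m :=
  w.f i x + ∑ j : Fin c, w.z i j (w.g j x)

/-- The family `𝒵` of all hash function pairs, viewed as structures from which the components can
be read off, with `f_1, f_2` from `Hm`, with `g_1, …, g_c` from `Hl`, and arbitrary tables. -/
def familyZ {U : Type*} {m ℓ : ℕ} (c : ℕ) (Hm : Set (U → Fin m)) (Hl : Set (U → Fin ℓ)) :
    Set (HashPair U m ℓ c) :=
  {w | (∀ i, w.f i ∈ Hm) ∧ ∀ j, w.g j ∈ Hl}

/-- The deficiency `d_T = |T| - max {k, |g_1(T)|, …, |g_c(T)|}`, an integer. -/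
def HashPair.deficiency {U : Type*} {m ℓ c : ℕ} (w : HashPair U m ℓ c)
    (k : ℕ) (T : Finset U) : ℤ :=
  (T.card : ℤ) -
    ((max k (Finset.univ.sup fun j : Fin c => (T.image (w.g j)).card) : ℕ) : ℤ)

/-- `(h_1, h_2)` is `T`-bad: its deficiency with respect to `T` exceeds `k`. -/
def HashPair.IsBad {U : Type*} {m ℓ c : ℕ} (w : HashPair U m ℓ c)
    (k : ℕ) (T : Finset U) : Prop :=
  (k : ℤ) < w.deficiency k T

/-- The cuckoo graph `G(T, h_1, h_2)`: the bipartite multigraph whose vertices are two disjoint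
copies of `[m]`, with one edge for each key `x ∈ T`, joining `h_1(x)` in the first copy to
`h_2(x)` in the second copy. -/
def cuckooGraph {U : Type*} {m : ℕ} (T : Finset U) (h₁ h₂ : U → Fin m) :
    Graph (Fin m ⊕ Fin m) U where
  vertexSet := Set.univ
  edgeSet := {x | x ∈ T}
  IsLink x u v := x ∈ T ∧
    ((u = Sum.inl (h₁ x) ∧ v = Sum.inr (h₂ x)) ∨ (u = Sum.inr (h₂ x) ∧ v = Sum.inl (h₁ x)))
  isLink_symm := fun _ _ => ⟨fun _ _ h => ⟨h.1, h.2.symm.imp (fun p => ⟨p.2, p.1⟩)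
    (fun p => ⟨p.2, p.1⟩)⟩⟩
  eq_or_eq_of_isLink_of_isLink := by
    rintro e x y v w ⟨-, h⟩ ⟨-, h'⟩
    rcases h with ⟨rfl, rfl⟩ | ⟨rfl, rfl⟩ <;> rcases h' with ⟨rfl, rfl⟩ | ⟨rfl, rfl⟩ <;> simp
  edge_mem_iff_exists_isLink := fun e =>
    ⟨fun h => ⟨_, _, h, Or.inl ⟨rfl, rfl⟩⟩, fun ⟨_, _, h⟩ => h.1⟩
  left_mem_of_isLink := fun _ _ _ _ => Set.mem_univ _

/-- The degree of a vertex of a multigraph: the number of incident edges, loops counted twice. -/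
noncomputable def degree {α β : Type*} (G : Graph α β) (v : α) : ℕ∞ :=
  {e | G.Inc e v}.encard + {e | G.IsLoopAt e v}.encard

/-- A multigraph is leafless if it has no leaves, that is, no vertices of degree `1`. -/
def IsLeafless {α β : Type*} (G : Graph α β) : Prop :=
  ∀ v ∈ G.vertexSet, degree G v ≠ 1

/-- The event that `G(T, h_1, h_2)` is leafless and `(h_1, h_2)` is `T`-bad
for at least one `T ⊆ S`. -/
def leaflessBadEvent {U : Type*} {m ℓ c : ℕ} [NeZero m] (k : ℕ) (S : Finset U) :
    Set (HashPair U m ℓ c) :=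
  {w | ∃ T ⊆ S, IsLeafless (cuckooGraph T (w.hash 0) (w.hash 1)) ∧ w.IsBad k T}

end CuckooHash

/-! A leaf is a singleton fibre of `h_1` or `h_2`. A union bound over the bad sets themselves fails:
large deficiency means many collisions under every `g_j`, and then the hash values on the set need
not be uniform. So a leafless bad set is shrunk to a subset on which two opposite features hold at
once.

On the one hand the deficiency is at most `k`. Then some `g_j` is injective off `2k` keys, and
`2k`-wise independence together with the random tables gives prescribed values of `(h_1, h_2)` on
`t` keys with probability at most `m^(-2t)` (`card_solutions_mul_le`). On the other hand each `g_j`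
still takes at most `k` values on some `2k` keys, which costs a factor `O(ℓ^(-k))` per `j`, hence
`O(ℓ^(-ck))` in all (`card_collision_mul_le`). The shrinking (`exists_sparse_critical_subset`)
leaves at most two leaves and bounded excess.

Such sparse pairs of maps consist almost entirely of fibres of size two, so there are at most
`poly(t) * m^(t+1) * t!` of them (`card_sparseMaps_le`). As `choose n t * t! ≤ n^t`, sets of size
`t` contribute `poly(t) * n * (n/m)^(t-1)`, up to the factor `O(ℓ^(-ck))`. This is summable with sum
`O(n)`, since `n/m ≤ 1/(1+ε) < 1`. -/

namespace CuckooHash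

open Finset

/-! ### Fibre statistics: leaves, excess, and shrinking an edge set -/

section Fibers

variable {U α : Type*} [DecidableEq α]

/-- The number of elements of `T` that `u` maps to `v`. -/
def fiberCard (T : Finset U) (u : U → α) (v : α) : ℕ := #{x ∈ T | u x = v}

/-- The sum of `φ` over the sizes of all fibers of `u` on `T`. -/
def fiberSum [Fintype α] (φ : ℕ → ℕ) (T : Finset U) (u : U → α) : ℕ := ∑ v, φ (fiberCard T u v)

/-- The number of fibers of size one. -/
def leafCount [Fintype α] (T : Finset U) (u : U → α) : ℕ := fiberSum
    (fun n => if n = 1 then 1 else 0) T u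

/-- The total amount by which fiber sizes exceed two. -/
def excess [Fintype α] (T : Finset U) (u : U → α) : ℕ := fiberSum (fun n => n - 2) T u

theorem fiberCard_insert [DecidableEq U] {T : Finset U} {x : U} (hx : x ∉ T) (u : U → α) (v : α) :
    fiberCard (insert x T) u v = fiberCard T u v + if u x = v then 1 else 0 := by
  unfold fiberCard
  rw [filter_insert]
  split_ifs with h
  · rw [card_insert_of_notMem (by simp [hx])]
  · rfl

theorem fiberCard_mono {T T' : Finset U} (h : T ⊆ T') (u : U → α) (v : α) :
    fiberCard T u v ≤ fiberCard T' u v :=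
  card_le_card (filter_subset_filter _ h)

theorem fiberSum_congr [Fintype α] (φ : ℕ → ℕ) {T : Finset U} {u u' : U → α}
    (h : ∀ x ∈ T, u x = u' x) :
    fiberSum φ T u = fiberSum φ T u' := by
  unfold fiberSum fiberCard
  refine sum_congr rfl fun v _ => ?_
  rw [filter_congr fun x hx => by rw [h x hx]]

theorem fiberSum_insert [DecidableEq U] [Fintype α] (φ : ℕ → ℕ) {T : Finset U} {x : U}
    (hx : x ∉ T) (u : U → α) :
    fiberSum φ (insert x T) u + φ (fiberCard T u (u x)) =
      fiberSum φ T u + φ (fiberCard T u (u x) + 1) := by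
  unfold fiberSum
  rw [← add_sum_erase _ _ (mem_univ (u x)),
    ← add_sum_erase univ (fun v => φ (fiberCard T u v)) (mem_univ (u x)),
    sum_congr rfl (g := fun v => φ (fiberCard T u v)) fun v hv => by
      rw [fiberCard_insert hx, if_neg (ne_of_mem_erase hv).symm, add_zero],
    fiberCard_insert hx, if_pos rfl]
  ring

theorem fiberSum_le_card [Fintype α] {φ : ℕ → ℕ} (hφ : ∀ n, φ n ≤ n) (T : Finset U) (u : U → α) :
    fiberSum φ T u ≤ #T := by
  rw [card_eq_sum_card_fiberwise (f := u) (t := univ) (by simp)]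
  exact sum_le_sum fun v _ => hφ _

/-- Deleting an edge at a leaf destroys that leaf and creates at most one at the other end. If there
are no leaves, deleting any edge creates at most two. -/
theorem exists_erase_leafCount_le [DecidableEq U] [Fintype α] {T : Finset U} (hT : T.Nonempty)
    {u u' : U → α}
    (h : leafCount T u + leafCount T u' ≤ 2) :
    ∃ x ∈ T, leafCount (T.erase x) u + leafCount (T.erase x) u' ≤ 2 := by
  have key : ∀ (w : U → α), ∀ x ∈ T, leafCount (T.erase x) w ≤ leafCount T w + 1 ∧
      (fiberCard T w (w x) = 1 → leafCount (T.erase x) w + 1 ≤ leafCount T w) := by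
    intro w x hx
    have h1 := fiberSum_insert (fun n => if n = 1 then 1 else 0) (notMem_erase x T) w
    have h2 := fiberCard_insert (notMem_erase x T) w (w x)
    rw [insert_erase hx] at h1 h2
    rw [if_pos rfl] at h2
    simp only [← h2] at h1
    unfold leafCount
    constructor
    · split_ifs at h1 <;> omega
    · intro h3
      rw [if_pos h3, if_neg (by omega)] at h1
      omega
  have leaf : ∀ w : U → α, leafCount T w ≠ 0 → ∃ x ∈ T, fiberCard T w (w x) = 1 := by
    intro w hw
    obtain ⟨v, -, hv⟩ := exists_ne_zero_of_sum_ne_zero hw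
    have hv1 : fiberCard T w v = 1 := by
      by_contra hne
      exact hv (if_neg hne)
    obtain ⟨x, hx⟩ := card_pos.1 (show 0 < fiberCard T w v by omega)
    obtain ⟨hxT, rfl⟩ := mem_filter.1 hx
    exact ⟨x, hxT, hv1⟩
  by_cases h0 : leafCount T u = 0
  · by_cases h0' : leafCount T u' = 0
    · obtain ⟨x, hx⟩ := hT
      have := (key u x hx).1
      have := (key u' x hx).1
      exact ⟨x, hx, by omega⟩
    · obtain ⟨x, hx, hx1⟩ := leaf u' h0'
      have := (key u' x hx).2 hx1
      have := (key u x hx).1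
      exact ⟨x, hx, by omega⟩
  · obtain ⟨x, hx, hx1⟩ := leaf u h0
    have := (key u x hx).2 hx1
    have := (key u' x hx).1
    exact ⟨x, hx, by omega⟩

/-- Any set `W` of edges extends, within `T`, to a set whose leaves are leaves of `T` and whose
excess is controlled by the size of `W`. -/
theorem exists_extension [DecidableEq U] [Fintype α] {W T : Finset U} (hW : W ⊆ T) (u u' : U → α) :
    ∃ T', W ⊆ T' ∧ T' ⊆ T ∧ leafCount T' u ≤ leafCount T u ∧ leafCount T' u' ≤ leafCount T u' ∧
      excess T' u ≤ 2 * #W ∧ excess T' u' ≤ 2 * #W := by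
  -- The potential counts leaves plus excess: its values at 0, 1, 2, 3 are 0, 1, 0, 1.
  let φ : ℕ → ℕ := fun n => (if n = 1 then 1 else 0) + (n - 2)
  have hφ : ∀ n, φ n ≤ n := by
    intro n
    simp only [φ]
    split_ifs <;> omega
  have hsplit : ∀ (T : Finset U) (w : U → α), fiberSum φ T w = leafCount T w + excess T w :=
    fun T w => sum_add_distrib
  -- A largest set between `W` and `T` with potential at most `2 * #W`; `W` qualifies because `φ n ≤
  -- n` on both sides.
  obtain ⟨T', hT', hmax⟩ := exists_max_image
    {A ∈ T.powerset | W ⊆ A ∧ fiberSum φ A u + fiberSum φ A u' ≤ 2 * #W} card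
    ⟨W, by
      have h1 := fiberSum_le_card hφ W u
      have h2 := fiberSum_le_card hφ W u'
      simp only [mem_filter, mem_powerset, hW, Subset.refl, true_and]
      omega⟩
  simp only [mem_filter, mem_powerset] at hT' hmax
  obtain ⟨hT'T, hWT', hpot⟩ := hT'
  have step : ∀ w w' : U → α,
      (∀ A, fiberSum φ A u + fiberSum φ A u' = fiberSum φ A w + fiberSum φ A w') →
      leafCount T' w ≤ leafCount T w := by
    intro w w' hww
    refine sum_le_sum fun v _ => ?_
    beta_reduce
    by_cases h1 : fiberCard T' w v = 1
    · suffices h2 : fiberCard T w v = 1 by rw [h1, h2]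
      by_contra h2
      have h3 := fiberCard_mono hT'T w v
      obtain ⟨x, hxf, hxT'⟩ := exists_mem_notMem_of_card_lt_card
        (show #{x ∈ T' | w x = v} < #{x ∈ T | w x = v} by
          change fiberCard T' w v < fiberCard T w v
          omega)
      obtain ⟨hxT, rfl⟩ := mem_filter.1 hxf
      have hx : x ∉ T' := fun h => hxT' (mem_filter.2 ⟨h, rfl⟩)
      have e1 := fiberSum_insert φ hx w
      have e2 := fiberSum_insert φ hx w'
      rw [h1] at e1
      -- Adding `x` turns its singleton fibre into a pair, lowering the potential by one, and raises
      -- it by at most one on the other side. So `insert x T'` violates maximality.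
      have e3 : φ (fiberCard T' w' (w' x) + 1) ≤ φ (fiberCard T' w' (w' x)) + 1 := by
        simp only [φ]
        split_ifs <;> omega
      have e4 : φ 1 = 1 := rfl
      have e5 : φ (1 + 1) = 0 := rfl
      have e6 := hww T'
      have e7 := hww (insert x T')
      have := hmax (insert x T') ⟨insert_subset hxT hT'T, hWT'.trans (subset_insert _ _), by omega⟩
      rw [card_insert_of_notMem hx] at this
      omega
    · rw [if_neg h1]
      exact Nat.zero_le _
  have s1 := hsplit T' u
  have s2 := hsplit T' u'
  exact ⟨T', hWT', hT'T, step u u' fun _ => rfl, step u' u fun _ => add_comm _ _,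
    by omega, by omega⟩

end Fibers

/-! ### Collisions of a single function on a finite set -/

section Collisions

variable {U β : Type*} [DecidableEq β]

theorem card_image_add_card_le [DecidableEq U] {A B : Finset U} (h : A ⊆ B) (g : U → β) :
    #(B.image g) + #A ≤ #(A.image g) + #B := by
  have h1 : #(B.image g) ≤ #(A.image g) + #(B \ A) := by
    conv_lhs => rw [← union_sdiff_of_subset h, image_union]
    exact (card_union_le _ _).trans (Nat.add_le_add_left card_image_le _)
  have := card_sdiff_add_card_eq_card h
  omega

theorem two_mul_card_image_le {A : Finset U} {g : U → β}
    (h : ∀ x ∈ A, ∃ y ∈ A, y ≠ x ∧ g y = g x) : 2 * #(A.image g) ≤ #A := by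
  refine mul_card_image_le_card A 2 fun b hb => ?_
  obtain ⟨x, hx, rfl⟩ := mem_image.1 hb
  obtain ⟨y, hy, hyx, hg⟩ := h x hx
  exact one_lt_card.2 ⟨y, by simp [hy, hg], x, by simp [hx], hyx⟩

/-- In a minimal `A` with `#(g A) + k ≤ #A` equality holds and every key collides, as a key without
collision could be dropped. Hence `2 * #(g A) ≤ #A`, so `#A ≤ 2k`. Padding to `2k` keys adds at most
one value per key. -/
theorem exists_collision_subset [DecidableEq U] {T : Finset U} {g : U → β} {k : ℕ}
    (h : #(T.image g) + k ≤ #T) (hT : 2 * k ≤ #T) :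
    ∃ W ⊆ T, #W = 2 * k ∧ #(W.image g) ≤ k := by
  obtain ⟨A, hA, hmin⟩ := exists_min_image {A ∈ T.powerset | #(A.image g) + k ≤ #A} card
    ⟨T, by simp [h]⟩
  simp only [mem_filter, mem_powerset] at hA hmin
  obtain ⟨hAT, hA⟩ := hA
  have hA2 : #A ≤ 2 * k := by
    rcases A.eq_empty_or_nonempty with rfl | ⟨x₀, hx₀⟩
    · simp
    have hne : ∀ x ∈ A, #A < #((A.erase x).image g) + k + 1 := by
      intro x hx
      by_contra hlt
      have h1 := card_erase_add_one hx
      have := hmin (A.erase x) ⟨(erase_subset _ _).trans hAT, by omega⟩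
      omega
    have h2 := two_mul_card_image_le (A := A) (g := g) fun x hx => by
      by_contra! hno
      have h1 : g x ∉ (A.erase x).image g := fun hmem => by
        obtain ⟨y, hy, hyx⟩ := mem_image.1 hmem
        exact hno y (mem_of_mem_erase hy) (ne_of_mem_erase hy) hyx
      have h2 : #(A.image g) = #((A.erase x).image g) + 1 := by
        conv_lhs => rw [← insert_erase hx, image_insert]
        exact card_insert_of_notMem h1
      have := hne x hx
      omega
    have h3 := hne x₀ hx₀
    have h4 := card_le_card (image_subset_image (f := g) (erase_subset x₀ A))
    omega
  obtain ⟨W, hAW, hWT, hW⟩ := exists_subsuperset_card_eq hAT hA2 hT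
  refine ⟨W, hWT, hW, ?_⟩
  have := card_image_add_card_le hAW g
  omega

/-- The set `B` of colliding keys satisfies `#B ≤ #(g B) + k` and `2 * #(g B) ≤ #B`, hence `#B ≤
2k`; `A` is `B` padded. -/
theorem exists_injective_off [DecidableEq U] {T : Finset U} {g : U → β} {k : ℕ}
    (h : #T ≤ #(T.image g) + k) (hT : 2 * k ≤ #T) :
    ∃ A ⊆ T, #A = 2 * k ∧ ∀ x ∈ T \ A, ∀ y ∈ T, g x = g y → x = y := by
  set B := {x ∈ T | ∃ y ∈ T, y ≠ x ∧ g y = g x} with hB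
  have hBT : B ⊆ T := filter_subset _ _
  have h1 := two_mul_card_image_le (A := B) (g := g) fun x hx => by
    obtain ⟨hxT, y, hyT, hyx, hg⟩ := mem_filter.1 hx
    exact ⟨y, mem_filter.2 ⟨hyT, x, hxT, hyx.symm, hg.symm⟩, hyx, hg⟩
  have h2 := card_image_add_card_le hBT g
  obtain ⟨A, hBA, hAT, hA⟩ := exists_subsuperset_card_eq hBT (show #B ≤ 2 * k by omega) hT
  refine ⟨A, hAT, hA, fun x hx y hy hxy => ?_⟩
  by_contra hne
  exact (mem_sdiff.1 hx).2 (hBA (mem_filter.2 ⟨(mem_sdiff.1 hx).1, y, hy, Ne.symm hne, hxy.symm⟩))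

end Collisions

/-! ### Counting maps with few leaves and small excess -/

section Counting

variable {U : Type*} [DecidableEq U] {m : ℕ}

/-- Functions vanishing outside `T` which on `T` have at most `a` singleton fibers and excess at
most `K`. -/
def sparseMaps [Fintype U] (m : ℕ) [NeZero m] (T : Finset U) (a K : ℕ) : Finset (U → Fin m) :=
  {u | (∀ x ∉ T, u x = 0) ∧ leafCount T u ≤ a ∧ excess T u ≤ K}

theorem mem_sparseMaps [NeZero m] [Fintype U] {T : Finset U} {a K : ℕ} {u : U → Fin m} :
    u ∈ sparseMaps m T a K ↔ (∀ x ∉ T, u x = 0) ∧ leafCount T u ≤ a ∧ excess T u ≤ K := by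
  simp [sparseMaps]

theorem fiberSum_update (φ : ℕ → ℕ) {T : Finset U} {x : U} (hx : x ∉ T) (u : U → Fin m)
    (b : Fin m) : fiberSum φ T (Function.update u x b) = fiberSum φ T u :=
  fiberSum_congr φ fun _ hy => Function.update_of_ne (ne_of_mem_of_not_mem hy hx) _ _

theorem update_vanishes [NeZero m] {T : Finset U} {x : U} {u : U → Fin m}
    (hu : ∀ y ∉ insert x T, u y = 0) : ∀ y ∉ T, Function.update u x 0 y = 0 := by
  intro y hy
  by_cases hyx : y = x
  · rw [hyx, Function.update_self]
  · rw [Function.update_of_ne hyx]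
    exact hu y (by simp [hy, hyx])

theorem eq_of_update_eq {x : U} {u u' : U → Fin m} {b : Fin m} (h : u x = u' x)
    (h' : Function.update u x b = Function.update u' x b) : u = u' := by
  funext y
  by_cases hyx : y = x
  · rw [hyx, h]
  · simpa [hyx] using congrFun h' y

/-- First case of a recursion on a key `x`: it is alone in its fibre. Its value is free, and
removing it uses up one leaf. -/
theorem card_fiber_zero_le [NeZero m] [Fintype U] {T : Finset U} {x : U} (hx : x ∉ T) (a K : ℕ) :
    #{u ∈ sparseMaps m (insert x T) (a + 1) K | fiberCard T u (u x) = 0} ≤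
      m * #(sparseMaps m T a K) := by
  rw [show m * #(sparseMaps m T a K) = #((univ : Finset (Fin m)) ×ˢ sparseMaps m T a K) by simp]
  refine card_le_card_of_injOn (fun u => (u x, Function.update u x 0)) ?_ ?_
  · intro u hu
    obtain ⟨hu, h0⟩ := mem_filter.1 (mem_coe.1 hu)
    obtain ⟨hu, hl, he⟩ := mem_sparseMaps.1 hu
    refine mem_coe.2 (mem_product.2 ⟨mem_univ _, mem_sparseMaps.2 ⟨update_vanishes hu, ?_⟩⟩)
    unfold leafCount excess at *
    rw [fiberSum_update _ hx, fiberSum_update _ hx]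
    have h1 := fiberSum_insert (fun n => if n = 1 then 1 else 0) hx u
    have h2 := fiberSum_insert (fun n => n - 2) hx u
    rw [h0] at h1 h2
    norm_num at h1 h2
    omega
  · intro u _ u' _ h
    simp only [Prod.mk.injEq] at h
    exact eq_of_update_eq h.1 h.2

/-- Second case: `x` shares its fibre with exactly one key `y`. Both are removed, and only their
common value is free. -/
theorem card_fiber_one_le [NeZero m] [Fintype U] {T : Finset U} {x y : U} (hx : x ∉ T)
    (hy : y ∈ T) (a K : ℕ) :
    #{u ∈ sparseMaps m (insert x T) a K | fiberCard T u (u x) = 1 ∧ u y = u x} ≤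
      m * #(sparseMaps m (T.erase y) a K) := by
  rw [show m * #(sparseMaps m (T.erase y) a K) =
    #((univ : Finset (Fin m)) ×ˢ sparseMaps m (T.erase y) a K) by simp]
  have hxy : y ≠ x := ne_of_mem_of_not_mem hy hx
  refine card_le_card_of_injOn
    (fun u => (u x, Function.update (Function.update u x 0) y 0)) ?_ ?_
  · intro u hu
    obtain ⟨hu, h1, hyx⟩ := mem_filter.1 (mem_coe.1 hu)
    obtain ⟨hu, hl, he⟩ := mem_sparseMaps.1 hu
    refine mem_coe.2 (mem_product.2 ⟨mem_univ _, mem_sparseMaps.2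
      ⟨update_vanishes (by rw [insert_erase hy]; exact update_vanishes hu), ?_⟩⟩)
    unfold leafCount excess at *
    have hx' : x ∉ T.erase y := fun h => hx (mem_of_mem_erase h)
    rw [fiberSum_update _ (notMem_erase y T), fiberSum_update _ (notMem_erase y T),
      fiberSum_update _ hx', fiberSum_update _ hx']
    have e1 := fiberSum_insert (fun n => if n = 1 then 1 else 0) hx u
    have e2 := fiberSum_insert (fun n => n - 2) hx u
    have e3 := fiberSum_insert (fun n => if n = 1 then 1 else 0) (notMem_erase y T) u
    have e4 := fiberSum_insert (fun n => n - 2) (notMem_erase y T) u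
    have e5 := fiberCard_insert (notMem_erase y T) u (u y)
    rw [insert_erase hy] at e3 e4 e5
    rw [hyx, h1, if_pos rfl] at e5
    have e6 : fiberCard (T.erase y) u (u x) = 0 := by omega
    rw [hyx, e6] at e3 e4
    rw [h1] at e1 e2
    norm_num at e1 e2 e3 e4
    omega
  · intro u hu u' hu' h
    have hu := (mem_filter.1 (mem_coe.1 hu)).2.2
    have hu' := (mem_filter.1 (mem_coe.1 hu')).2.2
    simp only [Prod.mk.injEq] at h
    exact eq_of_update_eq h.1
      (eq_of_update_eq (by simp [hxy, hu, hu', h.1]) h.2)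

/-- Third case: the fibre has at least three keys. The value at `x` is read off from `y`, and
removing `x` lowers the excess by one. -/
theorem card_fiber_large_le [NeZero m] [Fintype U] {T : Finset U} {x y : U} (hx : x ∉ T)
    (hy : y ∈ T) (a K : ℕ) :
    #{u ∈ sparseMaps m (insert x T) a (K + 1) | 2 ≤ fiberCard T u (u x) ∧ u y = u x} ≤
      #(sparseMaps m T a K) := by
  have hxy : y ≠ x := ne_of_mem_of_not_mem hy hx
  refine card_le_card_of_injOn (fun u => Function.update u x 0) ?_ ?_
  · intro u hu
    obtain ⟨hu, h2, -⟩ := mem_filter.1 (mem_coe.1 hu)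
    obtain ⟨hu, hl, he⟩ := mem_sparseMaps.1 hu
    refine mem_coe.2 (mem_sparseMaps.2 ⟨update_vanishes hu, ?_⟩)
    unfold leafCount excess at *
    rw [fiberSum_update _ hx, fiberSum_update _ hx]
    have e1 := fiberSum_insert (fun n => if n = 1 then 1 else 0) hx u
    have e2 := fiberSum_insert (fun n => n - 2) hx u
    beta_reduce at e1 e2
    rw [if_neg (by omega), if_neg (by omega)] at e1
    omega
  · intro u hu u' hu' h
    have hu := (mem_filter.1 (mem_coe.1 hu)).2.2
    have hu' := (mem_filter.1 (mem_coe.1 hu')).2.2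
    refine eq_of_update_eq ?_ h
    have := congrFun h y
    simpa [hxy, hu, hu'] using this

theorem card_fiber_zero_eq_zero [NeZero m] [Fintype U] {T : Finset U} {x : U} (hx : x ∉ T) (K : ℕ) :
    #{u ∈ sparseMaps m (insert x T) 0 K | fiberCard T u (u x) = 0} = 0 := by
  rw [card_eq_zero, filter_eq_empty_iff]
  intro u hu h0
  have h1 := fiberSum_insert (fun n => if n = 1 then 1 else 0) hx u
  have := (mem_sparseMaps.1 hu).2.1
  unfold leafCount at this
  rw [h0] at h1
  norm_num at h1
  omega

theorem card_fiber_large_eq_zero [NeZero m] [Fintype U] {T : Finset U} {x : U} (hx : x ∉ T)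
    (y : U) (a : ℕ) :
    #{u ∈ sparseMaps m (insert x T) a 0 | 2 ≤ fiberCard T u (u x) ∧ u y = u x} = 0 := by
  rw [card_eq_zero, filter_eq_empty_iff]
  intro u hu h0
  have e2 := fiberSum_insert (fun n => n - 2) hx u
  have := (mem_sparseMaps.1 hu).2.2
  unfold excess at this
  beta_reduce at e2
  omega

theorem card_sparseMaps_insert_le [NeZero m] [Fintype U] (T : Finset U) (x : U) (a K : ℕ) :
    #(sparseMaps m (insert x T) a K) ≤
      #{u ∈ sparseMaps m (insert x T) a K | fiberCard T u (u x) = 0} +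
      ∑ y ∈ T, #{u ∈ sparseMaps m (insert x T) a K | fiberCard T u (u x) = 1 ∧ u y = u x} +
      ∑ y ∈ T, #{u ∈ sparseMaps m (insert x T) a K | 2 ≤ fiberCard T u (u x) ∧ u y = u x} := by
  classical
  refine le_trans (card_le_card (t :=
    {u ∈ sparseMaps m (insert x T) a K | fiberCard T u (u x) = 0} ∪
    T.biUnion (fun y => {u ∈ sparseMaps m (insert x T) a K | fiberCard T u (u x) = 1 ∧ u y = u x}) ∪
    T.biUnion fun y => {u ∈ sparseMaps m (insert x T) a K | 2 ≤ fiberCard T u (u x) ∧ u y = u x})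
    ?_) ?_
  · intro u hu
    have hex : fiberCard T u (u x) ≠ 0 → ∃ y ∈ T, u y = u x := fun h => by
      obtain ⟨y, hy⟩ := card_pos.1 (Nat.pos_of_ne_zero h)
      exact ⟨y, mem_filter.1 hy⟩
    simp only [mem_union, mem_filter, mem_biUnion, hu, true_and]
    by_cases h0 : fiberCard T u (u x) = 0
    · exact Or.inl (Or.inl h0)
    · obtain ⟨y, hy, hyx⟩ := hex h0
      by_cases h1 : fiberCard T u (u x) = 1
      · exact Or.inl (Or.inr ⟨y, hy, h1, hyx⟩)
      · exact Or.inr ⟨y, hy, by omega, hyx⟩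
  · refine (card_union_le _ _).trans (add_le_add ((card_union_le _ _).trans
      (add_le_add le_rfl card_biUnion_le)) card_biUnion_le)

/-- The bound for the number of functions in `sparseMaps`. -/
noncomputable def sparseBound (m t a K : ℕ) : ℝ :=
  (t + 1 : ℝ) ^ (2 * (a + K)) * (√m ^ (t + a) * √(t.factorial : ℝ))

/-- With no leaves and no excess the map is a pairing with one value per pair, giving the main term
`√m ^ t * √t!`. Each leaf costs an extra `√m` and a polynomial factor, each unit of excess only a
polynomial factor. -/
theorem card_sparseMaps_le [NeZero m] [Fintype U] (T : Finset U) (a K : ℕ) :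
    (#(sparseMaps m T a K) : ℝ) ≤ sparseBound m #T a K := by
  have hm : (1 : ℝ) ≤ m := by exact_mod_cast NeZero.one_le
  have hsm : (1 : ℝ) ≤ √m := Real.one_le_sqrt.2 hm
  have hmm : √(m : ℝ) * √m = m := Real.mul_self_sqrt (by positivity)
  induction hn : #T using Nat.strong_induction_on generalizing T a K with
  | _ n ih =>
  rcases n with _ | t
  · obtain rfl := card_eq_zero.1 hn
    have h1 : #(sparseMaps m (∅ : Finset U) a K) ≤ 1 := by
      refine card_le_one.2 fun u hu u' hu' => funext fun x => ?_
      rw [(mem_sparseMaps.1 hu).1 x (by simp), (mem_sparseMaps.1 hu').1 x (by simp)]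
    calc (#(sparseMaps m (∅ : Finset U) a K) : ℝ) ≤ 1 := by exact_mod_cast h1
      _ ≤ _ := by simpa [sparseBound] using one_le_pow₀ hsm
  obtain ⟨x, T', hx, rfl, hT'⟩ := card_eq_succ.1 hn
  set s : ℝ := √m ^ (t + 1 + a) * √((t + 1).factorial : ℝ) with hs
  have hs0 : 0 ≤ s := by positivity
  have hfac : √(t.factorial : ℝ) ≤ √((t + 1).factorial : ℝ) := by
    apply Real.sqrt_le_sqrt
    exact_mod_cast Nat.factorial_le (Nat.le_succ t)
  have b0 : (#{u ∈ sparseMaps m (insert x T') a K | fiberCard T' u (u x) = 0} : ℝ) ≤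
      if a + K = 0 then 0 else (t + 1 : ℝ) ^ (2 * (a + K) - 2) * s := by
    rcases a with _ | a
    · rw [card_fiber_zero_eq_zero hx]
      split_ifs
      · simp
      · simp only [Nat.cast_zero]
        positivity
    · rw [if_neg (by omega)]
      calc _ ≤ (m : ℝ) * #(sparseMaps m T' a K) := by exact_mod_cast card_fiber_zero_le hx a K
        _ ≤ m * sparseBound m t a K := by
          gcongr
          exact ih t (by omega) T' a K hT'
        _ = (t + 1 : ℝ) ^ (2 * (a + K)) * (√m ^ (t + 1 + (a + 1)) * √(t.factorial : ℝ)) := by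
          rw [sparseBound]
          generalize √(m : ℝ) = q at hmm ⊢
          rw [← hmm]
          ring
        _ ≤ (t + 1 : ℝ) ^ (2 * (a + K)) * s := by
          rw [hs]
          gcongr
        _ = _ := by
          congr 2
          omega
  have b1 : ((∑ y ∈ T', #{u ∈ sparseMaps m (insert x T') a K |
      fiberCard T' u (u x) = 1 ∧ u y = u x} : ℕ) : ℝ) ≤ (t : ℝ) ^ (2 * (a + K)) * s := by
    rcases t with _ | r
    · obtain rfl := card_eq_zero.1 hT'
      simp only [sum_empty, Nat.cast_zero]
      positivity
    · push_cast
      refine (sum_le_card_nsmul _ _ (m * sparseBound m r a K) fun y hy => ?_).trans ?_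
      · calc _ ≤ (m : ℝ) * #(sparseMaps m (T'.erase y) a K) := by
              exact_mod_cast card_fiber_one_le hx hy a K
          _ ≤ _ := by
            gcongr
            exact ih r (by omega) _ a K (by rw [card_erase_of_mem hy, hT']; rfl)
      -- Source of the square root of the factorial: choosing the partner of `x` gives one linear
      -- factor per two keys removed.
      · have hf : (r + 1 : ℝ) * √(r.factorial : ℝ) ≤ √((r + 1 + 1).factorial : ℝ) := by
          apply Real.le_sqrt_of_sq_le
          rw [mul_pow, Real.sq_sqrt (by positivity)]
          push_cast [Nat.factorial_succ]
          have : (0 : ℝ) ≤ r.factorial := by positivity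
          nlinarith [mul_nonneg (show (0 : ℝ) ≤ r + 1 by positivity) this]
        rw [hT', nsmul_eq_mul]
        calc _ = (r + 1 : ℝ) ^ (2 * (a + K)) *
              (√m ^ (r + 1 + 1 + a) * ((r + 1 : ℝ) * √(r.factorial : ℝ))) := by
              rw [sparseBound]
              generalize √(m : ℝ) = q at hmm ⊢
              rw [← hmm]
              push_cast
              ring
          _ ≤ (r + 1 : ℝ) ^ (2 * (a + K)) * s := by
            rw [hs]
            gcongr
          _ = _ := rfl
  have b2 : ((∑ y ∈ T', #{u ∈ sparseMaps m (insert x T') a K |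
      2 ≤ fiberCard T' u (u x) ∧ u y = u x} : ℕ) : ℝ) ≤
      if a + K = 0 then 0 else t * (t + 1 : ℝ) ^ (2 * (a + K) - 2) * s := by
    rcases K with _ | K
    · rw [sum_congr rfl fun y _ => card_fiber_large_eq_zero hx y a, sum_const_zero]
      split_ifs
      · simp
      · simp only [Nat.cast_zero]
        positivity
    · rw [if_neg (by omega)]
      push_cast
      refine (sum_le_card_nsmul _ _ (sparseBound m t a K) fun y hy => ?_).trans ?_
      · calc _ ≤ (#(sparseMaps m T' a K) : ℝ) := by
              exact_mod_cast card_fiber_large_le hx hy a K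
          _ ≤ _ := ih t (by omega) _ a K hT'
      · rw [hT', nsmul_eq_mul, sparseBound, mul_assoc, hs,
          show 2 * (a + (K + 1)) - 2 = 2 * (a + K) by omega]
        gcongr
        omega
  have htot : (#(sparseMaps m (insert x T') a K) : ℝ) ≤ _ :=
    Nat.cast_le.2 (card_sparseMaps_insert_le T' x a K)
  rw [Nat.cast_add, Nat.cast_add] at htot
  refine (htot.trans (add_le_add (add_le_add b0 b1) b2)).trans ?_
  rw [sparseBound, ← hs]
  by_cases h0 : a + K = 0
  · simp [h0]
  · rw [if_neg h0, if_neg h0]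
    -- The two spare powers absorb the first and third cases: `(t+1)^d + t^(d+2) + t(t+1)^d ≤
    -- (t+2)^(d+2)`.
    obtain ⟨d, hd⟩ : ∃ d, 2 * (a + K) = d + 2 := ⟨2 * (a + K) - 2, by omega⟩
    rw [hd, Nat.add_sub_cancel, ← add_mul, ← add_mul]
    gcongr
    push_cast
    calc (t + 1 : ℝ) ^ d + t ^ (d + 2) + t * (t + 1) ^ d
        ≤ (t + 1 : ℝ) ^ d + (t + 1) ^ d * t ^ 2 + t * (t + 1) ^ d := by
          rw [pow_add (t : ℝ)]
          gcongr
          linarith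
      _ = (t + 1 : ℝ) ^ d * (1 + t ^ 2 + t) := by ring
      _ ≤ (t + 1 + 1 : ℝ) ^ d * (t + 1 + 1) ^ 2 := by
          have ht : (0 : ℝ) ≤ t := by positivity
          gcongr
          · linarith
          · nlinarith
      _ = _ := by ring

end Counting

/-! ### Probabilities for the hash families, as counts -/

section HashCounting

variable {U : Type*} [DecidableEq U] [Fintype U]

/-- Independence of a finite hash family, as an exact count. -/
theorem IsWiseIndependent.card_filter_mul {r κ : ℕ} {F : Finset (U → Fin r)}
    (hF : IsWiseIndependent κ (F : Set (U → Fin r))) {A : Finset U} (hA : #A = κ)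
    (u : U → Fin r) : #{f ∈ F | ∀ x ∈ A, f x = u x} * r ^ κ = #F := by
  rcases F.eq_empty_or_nonempty with rfl | hne
  · simp
  let e := A.equivFinOfCardEq hA
  have h := hF.2 (fun i => (e.symm i : U)) (Subtype.val_injective.comp e.symm.injective)
    fun i => u (e.symm i)
  have hset : (F : Set (U → Fin r)) ∩ {h | ∀ i, h (e.symm i : U) = u (e.symm i)} =
      (({f ∈ F | ∀ x ∈ A, f x = u x} : Finset (U → Fin r)) : Set (U → Fin r)) := by
    ext f
    simp only [Set.mem_inter_iff, mem_coe, Set.mem_ofPred_eq, mem_filter]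
    refine and_congr_right fun _ => ⟨fun h x hx => ?_, fun h i => h _ (e.symm i).2⟩
    simpa using h (e ⟨x, hx⟩)
  rw [uniformProb, hset, Set.ncard_coe_finset, Set.ncard_coe_finset] at h
  have hF0 : (#F : ℝ) ≠ 0 := by exact_mod_cast (card_pos.2 hne).ne'
  obtain ⟨f, -⟩ := hne
  have hr : ((r : ℝ) ^ κ) ≠ 0 := by
    rcases κ with _ | κ
    · simp
    · obtain ⟨x, -⟩ := card_pos.1 (show 0 < #A by omega)
      have : r ≠ 0 := (Fin.pos (f x)).ne'
      positivity
  rw [div_eq_div_iff hF0 hr, one_mul] at h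
  exact_mod_cast h

theorem exists_range_of_card_le {ℓ k : ℕ} (hℓ : 1 ≤ ℓ) {B : Finset (Fin ℓ)} (hB : #B ≤ k) :
    ∃ b : Fin k → Fin ℓ, ∀ y ∈ B, ∃ i, b i = y := by
  obtain ⟨e⟩ := Function.Embedding.nonempty_of_card_le (α := B) (β := Fin k) (by simpa using hB)
  exact ⟨Function.extend e Subtype.val fun _ => ⟨0, hℓ⟩, fun y hy =>
    ⟨e ⟨y, hy⟩, e.injective.extend_apply Subtype.val _ ⟨y, hy⟩⟩⟩

/-- A function with at most `k` values on `W` factors there through `Fin k`, leaving `k^(2k) * ℓ^k`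
patterns, each of probability `ℓ^(-2k)`. -/
theorem card_collision_mul_le {ℓ k : ℕ} (hℓ : 1 ≤ ℓ) {F : Finset (U → Fin ℓ)}
    (hF : IsWiseIndependent (2 * k) (F : Set (U → Fin ℓ))) {W : Finset U} (hW : #W = 2 * k) :
    #{g ∈ F | #(W.image g) ≤ k} * ℓ ^ k ≤ #F * k ^ (2 * k) := by
  classical
  let u : (W → Fin k) × (Fin k → Fin ℓ) → U → Fin ℓ := fun p x =>
    if hx : x ∈ W then p.2 (p.1 ⟨x, hx⟩) else ⟨0, hℓ⟩
  have hcover : {g ∈ F | #(W.image g) ≤ k} ⊆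
      (univ : Finset ((W → Fin k) × (Fin k → Fin ℓ))).biUnion
        fun p => {g ∈ F | ∀ x ∈ W, g x = u p x} := by
    intro g hg
    obtain ⟨hgF, hg⟩ := mem_filter.1 hg
    obtain ⟨b, hb⟩ := exists_range_of_card_le hℓ hg
    choose a ha using fun x : W => hb (g x) (mem_image_of_mem g x.2)
    refine mem_biUnion.2 ⟨(a, b), mem_univ _, mem_filter.2 ⟨hgF, fun x hx => ?_⟩⟩
    simp only [u, dif_pos hx]
    exact (ha ⟨x, hx⟩).symm
  have hcard : Fintype.card ((W → Fin k) × (Fin k → Fin ℓ)) = k ^ (2 * k) * ℓ ^ k := by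
    simp [hW]
  have h1 : #{g ∈ F | #(W.image g) ≤ k} * ℓ ^ (2 * k) ≤ k ^ (2 * k) * ℓ ^ k * #F := by
    calc _ ≤ (∑ p : (W → Fin k) × (Fin k → Fin ℓ), #{g ∈ F | ∀ x ∈ W, g x = u p x}) *
          ℓ ^ (2 * k) := Nat.mul_le_mul_right _ ((card_le_card hcover).trans card_biUnion_le)
      _ = k ^ (2 * k) * ℓ ^ k * #F := by
        rw [sum_mul, sum_congr rfl fun p _ => hF.card_filter_mul hW (u p), sum_const, card_univ,
          hcard, smul_eq_mul]
  refine Nat.le_of_mul_le_mul_right ?_ (show 0 < ℓ ^ k by positivity)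
  calc _ = #{g ∈ F | #(W.image g) ≤ k} * ℓ ^ (2 * k) := by ring
    _ ≤ _ := h1
    _ = _ := by ring

variable {m ℓ c : ℕ} [NeZero m]

/-- The pairs of a function from `F` and tables for which the resulting hash function agrees with
`u` on `T`. -/
def solutions (F : Finset (U → Fin m)) (g : Fin c → U → Fin ℓ) (T : Finset U) (u : U → Fin m) :
    Finset ((U → Fin m) × (Fin c → Fin ℓ → Fin m)) :=
  {p ∈ F ×ˢ univ | ∀ x ∈ T, p.1 x + ∑ j, p.2 j (g j x) = u x}

/-- The table entry at `g j x` is not read by any key of `T`. Shifting it by `s` preserves a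
solution on `T`, and the value at `x` then reveals `s`. -/
theorem card_solutions_insert_mul_le (F : Finset (U → Fin m)) (g : Fin c → U → Fin ℓ)
    {T : Finset U} (u : U → Fin m) {x : U} {j : Fin c} (hx : ∀ y ∈ T, g j y ≠ g j x) :
    #(solutions F g (insert x T) u) * m ≤ #(solutions F g T u) := by
  rw [show #(solutions F g (insert x T) u) * m =
    #(solutions F g (insert x T) u ×ˢ (univ : Finset (Fin m))) by simp]
  have hshift : ∀ (z : Fin c → Fin ℓ → Fin m) (s : Fin m) (y : U),
      ∑ i, (z + Pi.single j (Pi.single (g j x) s) : Fin c → Fin ℓ → Fin m) i (g i y) =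
        ∑ i, z i (g i y) + if g j y = g j x then s else 0 := by
    intro z s y
    simp only [Pi.add_apply, sum_add_distrib]
    congr 1
    rw [sum_eq_single j (fun i _ hi => by rw [Pi.single_eq_of_ne hi]; rfl) (by simp),
      Pi.single_eq_same, Pi.single_apply]
  refine card_le_card_of_injOn
    (fun q => (q.1.1, q.1.2 + Pi.single j (Pi.single (g j x) q.2))) ?_ ?_
  · rintro ⟨⟨f, z⟩, s⟩ hq
    obtain ⟨hmem, hsol⟩ := mem_filter.1 (mem_product.1 (mem_coe.1 hq)).1
    refine mem_coe.2 (mem_filter.2 ⟨mem_product.2 ⟨(mem_product.1 hmem).1, mem_univ _⟩, ?_⟩)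
    intro y hy
    rw [hshift, if_neg (hx y hy), add_zero]
    exact hsol y (mem_insert_of_mem hy)
  · rintro ⟨⟨f, z⟩, s⟩ hq ⟨⟨f', z'⟩, s'⟩ hq' h
    have hs := (mem_filter.1 (mem_product.1 (mem_coe.1 hq)).1).2 x (mem_insert_self _ _)
    have hs' := (mem_filter.1 (mem_product.1 (mem_coe.1 hq')).1).2 x (mem_insert_self _ _)
    simp only [Prod.mk.injEq] at h hs hs'
    obtain ⟨rfl, h⟩ := h
    have hz := congrArg (fun z : Fin c → Fin ℓ → Fin m => ∑ i, z i (g i x)) h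
    simp only [hshift, if_true] at hz
    rw [add_left_cancel (hs.trans hs'.symm)] at hz
    obtain rfl := add_left_cancel hz
    rw [add_right_cancel h]

theorem card_solutions_union_mul_le (F : Finset (U → Fin m)) (g : Fin c → U → Fin ℓ)
    (u : U → Fin m) (A : Finset U) (j : Fin c) (R : Finset U) (hAR : Disjoint A R)
    (hR : ∀ x ∈ R, ∀ y ∈ A ∪ R, g j x = g j y → x = y) :
    #(solutions F g (A ∪ R) u) * m ^ #R ≤ #(solutions F g A u) := by
  induction R using Finset.induction_on with
  | empty => simp
  | insert x R hx ih =>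
    rw [disjoint_insert_right] at hAR
    have h1 := ih hAR.2 fun a ha b hb => hR a (mem_insert_of_mem ha) b (by
      rw [union_insert]
      exact mem_insert_of_mem hb)
    have h2 := card_solutions_insert_mul_le F g (T := A ∪ R) u (x := x) (j := j) fun y hy hxy => by
      obtain rfl := hR x (mem_insert_self _ _) y
        (by rw [union_insert]; exact mem_insert_of_mem hy) hxy.symm
      rcases mem_union.1 hy with h | h
      · exact hAR.1 h
      · exact hx h
    rw [union_insert, card_insert_of_notMem hx, pow_succ', ← mul_assoc]
    exact (Nat.mul_le_mul_right _ h2).trans h1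

/-- Once the tables are fixed, the values of `f` on `A` are prescribed. -/
theorem card_solutions_mul_le_of_independent {κ : ℕ} {F : Finset (U → Fin m)}
    (hF : IsWiseIndependent κ (F : Set (U → Fin m))) (g : Fin c → U → Fin ℓ) (u : U → Fin m)
    {A : Finset U} (hA : #A = κ) :
    #(solutions F g A u) * m ^ κ ≤ #F * (m ^ ℓ) ^ c := by
  classical
  have hfib : ∀ z : Fin c → Fin ℓ → Fin m,
      #{p ∈ solutions F g A u | p.2 = z} * m ^ κ ≤ #F := by
    intro z
    rw [← hF.card_filter_mul hA fun x => u x - ∑ j, z j (g j x)]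
    refine Nat.mul_le_mul_right _ (card_le_card_of_injOn Prod.fst ?_ ?_)
    · rintro ⟨f, z'⟩ hp
      obtain ⟨hp', h⟩ := mem_filter.1 (mem_coe.1 hp)
      obtain rfl : z' = z := h
      obtain ⟨hp, hsol⟩ := mem_filter.1 hp'
      exact mem_coe.2 (mem_filter.2
        ⟨(mem_product.1 hp).1, fun x hx => eq_sub_of_add_eq (hsol x hx)⟩)
    · rintro ⟨f, z₁⟩ h₁ ⟨f', z₂⟩ h₂ h
      have h₁ := (mem_filter.1 (mem_coe.1 h₁)).2
      have h₂ := (mem_filter.1 (mem_coe.1 h₂)).2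
      simp only at h₁ h₂ h
      rw [h, h₁, h₂]
  rw [card_eq_sum_card_fiberwise (f := Prod.snd) (t := univ) (by simp), sum_mul]
  refine (sum_le_card_nsmul _ _ _ fun z _ => hfib z).trans_eq ?_
  simp [mul_comm]

/-- If some `g j` is injective off a set of `κ` keys, the hash values on `T` are uniform. -/
theorem card_solutions_mul_le {κ : ℕ} {F : Finset (U → Fin m)}
    (hF : IsWiseIndependent κ (F : Set (U → Fin m))) (g : Fin c → U → Fin ℓ) (u : U → Fin m)
    {A T : Finset U} (hA : #A = κ) (hAT : A ⊆ T) {j : Fin c}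
    (hg : ∀ x ∈ T \ A, ∀ y ∈ T, g j x = g j y → x = y) :
    #(solutions F g T u) * m ^ #T ≤ #F * (m ^ ℓ) ^ c := by
  have h1 := card_solutions_union_mul_le F g u A j (T \ A) disjoint_sdiff
    (by rwa [union_sdiff_of_subset hAT])
  rw [union_sdiff_of_subset hAT] at h1
  rw [← card_sdiff_add_card_eq_card hAT, pow_add, ← mul_assoc, hA]
  exact (Nat.mul_le_mul_right _ h1).trans (card_solutions_mul_le_of_independent hF g u hA)

end HashCounting

/-! ### Deficiency and the reduction to critical sets -/

section Deficiency

variable {U : Type*} {m ℓ c k : ℕ}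

theorem le_deficiency_iff (w : HashPair U m ℓ c) (T : Finset U) (d : ℕ) :
    (d : ℤ) ≤ w.deficiency k T ↔
      d + k ≤ #T ∧ ∀ j, #(T.image (w.g j)) + d ≤ #T := by
  have h : (d : ℤ) ≤ w.deficiency k T ↔
      d + max k (univ.sup fun j : Fin c => #(T.image (w.g j))) ≤ #T := by
    unfold HashPair.deficiency
    omega
  rw [h]
  constructor
  · intro h
    refine ⟨by omega, fun j => ?_⟩
    have := le_sup (f := fun j : Fin c => #(T.image (w.g j))) (mem_univ j)
    omega
  · rintro ⟨h1, h2⟩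
    have h3 : (univ.sup fun j : Fin c => #(T.image (w.g j))) ≤ #T - d :=
      Finset.sup_le fun j _ => by have := h2 j; omega
    omega

theorem deficiency_lt_iff (w : HashPair U m ℓ c) (T : Finset U) (d : ℕ) :
    w.deficiency k T < d ↔ #T < d + k ∨ ∃ j, #T < #(T.image (w.g j)) + d := by
  rw [← not_le, le_deficiency_iff]
  simp only [not_and_or, not_le, not_forall]

/-- A new key adds one to the size and at most one to each image. -/
theorem deficiency_mono [DecidableEq U] (w : HashPair U m ℓ c) {A B : Finset U} (h : A ⊆ B) :
    w.deficiency k A ≤ w.deficiency k B := by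
  unfold HashPair.deficiency
  have hAB := card_le_card h
  have h1 : (univ.sup fun j : Fin c => #(B.image (w.g j))) ≤
      (univ.sup fun j : Fin c => #(A.image (w.g j))) + (#B - #A) := by
    refine Finset.sup_le fun j _ => ?_
    have h2 := le_sup (f := fun j : Fin c => #(A.image (w.g j))) (mem_univ j)
    have h3 := card_image_add_card_le h (w.g j)
    beta_reduce at h2
    omega
  omega

theorem deficiency_le_erase_add_one [DecidableEq U] (w : HashPair U m ℓ c) {T : Finset U} {x : U}
    (hx : x ∈ T) :
    w.deficiency k T ≤ w.deficiency k (T.erase x) + 1 := by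
  unfold HashPair.deficiency
  have h1 : (univ.sup fun j : Fin c => #((T.erase x).image (w.g j))) ≤
      univ.sup fun j : Fin c => #(T.image (w.g j)) :=
    Finset.sup_mono_fun fun j _ => card_le_card (image_subset_image (erase_subset _ _))
  have h2 := card_erase_add_one hx
  omega

/-- Edges are deleted one at a time with at most two leaves present. The deficiency drops by at most
one per deletion, so it cannot jump over `k`. -/
theorem exists_critical_subset [DecidableEq U] (hk : 1 ≤ k) (w : HashPair U m ℓ c)
    (u u' : U → Fin m)
    (T : Finset U) (hT : leafCount T u + leafCount T u' ≤ 2) (hd : (k : ℤ) ≤ w.deficiency k T) :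
    ∃ A ⊆ T, leafCount A u + leafCount A u' ≤ 2 ∧ w.deficiency k A = k := by
  induction T using Finset.strongInduction with
  | H T ih =>
    by_cases h : w.deficiency k T = k
    · exact ⟨T, Subset.rfl, hT, h⟩
    have hne : T.Nonempty := card_pos.1 (by have := ((le_deficiency_iff w T k).1 hd).1; omega)
    obtain ⟨x, hx, hL⟩ := exists_erase_leafCount_le hne hT
    have h1 := deficiency_le_erase_add_one (k := k) w hx
    obtain ⟨A, hA, hA'⟩ := ih _ (erase_ssubset hx) hL (by omega)
    exact ⟨A, hA.trans (erase_subset _ _), hA'⟩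

/-- The core of the reduction: every bad set whose graph has no leaf contains a critical set with
at most two leaves, of bounded excess, with witnesses for its deficiency. -/
theorem exists_sparse_critical_subset [DecidableEq U] (hk : 1 ≤ k) (hc : 1 ≤ c)
    (w : HashPair U m ℓ c) (u u' : U → Fin m)
    {T : Finset U} (hT : leafCount T u + leafCount T u' ≤ 2)
    (hd : (k : ℤ) ≤ w.deficiency k T) :
    ∃ A ⊆ T, 2 * k ≤ #A ∧ leafCount A u + leafCount A u' ≤ 2 ∧
      excess A u ≤ 2 * (c * (2 * k)) ∧ excess A u' ≤ 2 * (c * (2 * k)) ∧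
      w.deficiency k A ≤ k ∧
      ∃ W : Fin c → Finset U, ∀ j, W j ∈ powersetCard (2 * k) A ∧ #((W j).image (w.g j)) ≤ k := by
  obtain ⟨B, hBT, hBL, hBd⟩ := exists_critical_subset hk w u u' T hT hd
  obtain ⟨hBk, hBg⟩ := (le_deficiency_iff w B k).1 hBd.ge
  choose W hWB hWcard hWg using fun j => exists_collision_subset (hBg j) (by omega)
  have hWsub : univ.biUnion W ⊆ B := biUnion_subset.2 fun j _ => hWB j
  have hWle : #(univ.biUnion W) ≤ c * (2 * k) := by
    refine card_biUnion_le.trans ?_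
    simp [hWcard]
  obtain ⟨A, hWA, hAB, hl, hl', he, he'⟩ := exists_extension hWsub u u'
  have hWA' : ∀ j, W j ⊆ A := fun j => (subset_biUnion_of_mem W (mem_univ j)).trans hWA
  refine ⟨A, hAB.trans hBT, ?_, by omega, by omega, by omega,
    (deficiency_mono w hAB).trans hBd.le, W, fun j =>
      ⟨mem_powersetCard.2 ⟨hWA' j, hWcard j⟩, hWg j⟩⟩
  rw [← hWcard ⟨0, hc⟩]
  exact card_le_card (hWA' _)

theorem exists_injective_off_of_deficiency_le [DecidableEq U] (hc : 1 ≤ c) (w : HashPair U m ℓ c)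
    {T : Finset U}
    (hT : 2 * k ≤ #T) (hd : w.deficiency k T ≤ k) :
    ∃ A ⊆ T, #A = 2 * k ∧ ∃ j, ∀ x ∈ T \ A, ∀ y ∈ T, w.g j x = w.g j y → x = y := by
  rcases (deficiency_lt_iff (k := k) w T (k + 1)).1 (by push_cast; omega) with h | ⟨j, hj⟩
  -- Here `#T = 2k` exactly, so nothing lies outside `A = T` and any index serves.
  · exact ⟨T, Subset.rfl, by omega, ⟨0, hc⟩, by simp⟩
  · obtain ⟨A, hAT, hA, h⟩ := exists_injective_off (show #T ≤ #(T.image (w.g j)) + k by omega) hT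
    exact ⟨A, hAT, hA, j, h⟩

end Deficiency

/-! ### From graph degrees to fibre sizes -/

section Leafless

variable {U : Type*} {m : ℕ}

theorem degree_cuckooGraph_inl (T : Finset U) (h₁ h₂ : U → Fin m) (v : Fin m) :
    degree (cuckooGraph T h₁ h₂) (Sum.inl v) = fiberCard T h₁ v := by
  have h1 : {e | (cuckooGraph T h₁ h₂).Inc e (Sum.inl v)} = ({x ∈ T | h₁ x = v} : Finset U) := by
    ext e
    simp [Graph.Inc, cuckooGraph, eq_comm]
  have h2 : {e | (cuckooGraph T h₁ h₂).IsLoopAt e (Sum.inl v)} = ∅ := by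
    ext e
    simp [Graph.IsLoopAt, cuckooGraph]
  rw [degree, h1, h2, Set.encard_empty, add_zero, Set.encard_coe_eq_coe_finsetCard, fiberCard]

theorem degree_cuckooGraph_inr (T : Finset U) (h₁ h₂ : U → Fin m) (v : Fin m) :
    degree (cuckooGraph T h₁ h₂) (Sum.inr v) = fiberCard T h₂ v := by
  have h1 : {e | (cuckooGraph T h₁ h₂).Inc e (Sum.inr v)} = ({x ∈ T | h₂ x = v} : Finset U) := by
    ext e
    simp [Graph.Inc, cuckooGraph, eq_comm]
  have h2 : {e | (cuckooGraph T h₁ h₂).IsLoopAt e (Sum.inr v)} = ∅ := by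
    ext e
    simp [Graph.IsLoopAt, cuckooGraph]
  rw [degree, h1, h2, Set.encard_empty, add_zero, Set.encard_coe_eq_coe_finsetCard, fiberCard]

theorem IsLeafless.leafCount_eq_zero {T : Finset U} {h₁ h₂ : U → Fin m}
    (h : IsLeafless (cuckooGraph T h₁ h₂)) : leafCount T h₁ = 0 ∧ leafCount T h₂ = 0 := by
  unfold leafCount fiberSum
  refine ⟨sum_eq_zero fun v _ => if_neg fun hv => ?_, sum_eq_zero fun v _ => if_neg fun hv => ?_⟩
  · exact h (Sum.inl v) (Set.mem_univ _) (by rw [degree_cuckooGraph_inl, hv, Nat.cast_one])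
  · exact h (Sum.inr v) (Set.mem_univ _) (by rw [degree_cuckooGraph_inr, hv, Nat.cast_one])

end Leafless

/-! ### The union bound and its summation -/

section UnionBound

variable {U : Type*} {m ℓ c : ℕ} [Fintype (HashPair U m ℓ c)]

open Classical in
/-- The family `familyZ` as a finite set. -/
noncomputable def familyFinset (c : ℕ) [Fintype (HashPair U m ℓ c)] (Fm : Finset (U → Fin m))
    (Fl : Finset (U → Fin ℓ)) : Finset (HashPair U m ℓ c) :=
  {w | (∀ i, w.f i ∈ Fm) ∧ ∀ j, w.g j ∈ Fl}

theorem mem_familyFinset {Fm : Finset (U → Fin m)} {Fl : Finset (U → Fin ℓ)}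
    {w : HashPair U m ℓ c} :
    w ∈ familyFinset c Fm Fl ↔ (∀ i, w.f i ∈ Fm) ∧ ∀ j, w.g j ∈ Fl := by
  simp [familyFinset]

theorem coe_familyFinset (Fm : Finset (U → Fin m)) (Fl : Finset (U → Fin ℓ)) :
    (familyFinset c Fm Fl : Set (HashPair U m ℓ c)) = familyZ c (Fm : Set _) (Fl : Set _) := by
  ext w
  simp [mem_familyFinset, familyZ]

theorem le_card_familyFinset (Fm : Finset (U → Fin m)) (Fl : Finset (U → Fin ℓ)) :
    (#Fm * (m ^ ℓ) ^ c) ^ 2 * #Fl ^ c ≤ #(familyFinset c Fm Fl) := by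
  classical
  rw [show (#Fm * (m ^ ℓ) ^ c) ^ 2 * #Fl ^ c =
    #((Fintype.piFinset fun _ : Fin 2 => Fm ×ˢ (univ : Finset (Fin c → Fin ℓ → Fin m))) ×ˢ
      Fintype.piFinset fun _ : Fin c => Fl) by simp]
  refine card_le_card_of_injOn
    (fun p => ⟨fun i => (p.1 i).1, p.2, fun i => (p.1 i).2⟩) ?_ ?_
  · intro p hp
    obtain ⟨h1, h2⟩ := mem_product.1 (mem_coe.1 hp)
    rw [Fintype.mem_piFinset] at h1 h2
    exact mem_coe.2 (mem_familyFinset.2 ⟨fun i => (mem_product.1 (h1 i)).1, h2⟩)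
  · rintro ⟨p, g⟩ _ ⟨p', g'⟩ _ h
    simp only [HashPair.mk.injEq] at h
    obtain ⟨h1, rfl, h2⟩ := h
    rw [show p = p' from funext fun i => Prod.ext (congrFun h1 i) (congrFun h2 i)]

open Classical in
/-- The members of the family whose hash functions agree with `u` on `T`, whose deficiency on `T`
is at most `k`, and whose functions `g j` have many collisions on `W j`. -/
noncomputable def hashEvent [NeZero m] (k : ℕ) (Fm : Finset (U → Fin m)) (Fl : Finset (U → Fin ℓ))
    (T : Finset U) (u : Fin 2 → U → Fin m) (W : Fin c → Finset U) : Finset (HashPair U m ℓ c) :=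
  {w ∈ familyFinset c Fm Fl | (∀ i, ∀ x ∈ T, w.hash i x = u i x) ∧ w.deficiency k T ≤ k ∧
    ∀ j, #((W j).image (w.g j)) ≤ k}

theorem mem_hashEvent [NeZero m] {k : ℕ} {Fm : Finset (U → Fin m)} {Fl : Finset (U → Fin ℓ)}
    {T : Finset U} {u : Fin 2 → U → Fin m} {W : Fin c → Finset U} {w : HashPair U m ℓ c} :
    w ∈ hashEvent k Fm Fl T u W ↔ w ∈ familyFinset c Fm Fl ∧
      (∀ i, ∀ x ∈ T, w.hash i x = u i x) ∧ w.deficiency k T ≤ k ∧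
        ∀ j, #((W j).image (w.g j)) ≤ k := by
  simp [hashEvent]

/-- The `g j` are fixed first: both the collisions and the injectivity off `2k` keys concern them
alone. For given `g`, the pairs `(f i, z i)` are independent for the two values of `i`, each
contributing `m^(-#T)`. -/
theorem card_hashEvent_mul_le [Fintype U] [DecidableEq U] [NeZero m] {k : ℕ} (hc : 1 ≤ c)
    (hℓ : 1 ≤ ℓ) {Fm : Finset (U → Fin m)} {Fl : Finset (U → Fin ℓ)}
    (hFm : IsWiseIndependent (2 * k) (Fm : Set (U → Fin m)))
    (hFl : IsWiseIndependent (2 * k) (Fl : Set (U → Fin ℓ)))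
    {T : Finset U} (hT : 2 * k ≤ #T) (u : Fin 2 → U → Fin m) {W : Fin c → Finset U}
    (hW : ∀ j, #(W j) = 2 * k) :
    #(hashEvent k Fm Fl T u W) * ((m ^ #T) ^ 2 * (ℓ ^ k) ^ c) ≤
      #(familyFinset c Fm Fl) * (k ^ (2 * k)) ^ c := by
  classical
  set G : Finset (Fin c → U → Fin ℓ) :=
    {g ∈ Fintype.piFinset fun j => {g ∈ Fl | #((W j).image g) ≤ k} |
      ∃ A ⊆ T, #A = 2 * k ∧ ∃ j, ∀ x ∈ T \ A, ∀ y ∈ T, g j x = g j y → x = y} with hG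
  have h1 : #(hashEvent k Fm Fl T u W) ≤
      #(G.sigma fun g => Fintype.piFinset fun i => solutions Fm g T (u i)) := by
    refine card_le_card_of_injOn (fun w => ⟨w.g, fun i => (w.f i, w.z i)⟩) ?_ ?_
    · intro w hw
      obtain ⟨hw, hu, hd, hcoll⟩ := mem_hashEvent.1 (mem_coe.1 hw)
      obtain ⟨hf, hg⟩ := mem_familyFinset.1 hw
      refine mem_coe.2 (mem_sigma.2 ⟨mem_filter.2 ⟨Fintype.mem_piFinset.2 fun j =>
        mem_filter.2 ⟨hg j, hcoll j⟩, exists_injective_off_of_deficiency_le hc w hT hd⟩,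
        Fintype.mem_piFinset.2 fun i => mem_filter.2
          ⟨mem_product.2 ⟨hf i, mem_univ _⟩, hu i⟩⟩)
    · rintro ⟨f, g, z⟩ _ ⟨f', g', z'⟩ _ h
      simp only [Sigma.mk.injEq] at h
      obtain ⟨rfl, h⟩ := h
      have h := eq_of_heq h
      rw [show f = f' from funext fun i => congrArg Prod.fst (congrFun h i),
        show z = z' from funext fun i => congrArg Prod.snd (congrFun h i)]
  have h2 : #(G.sigma fun g => Fintype.piFinset fun i => solutions Fm g T (u i)) *
      (m ^ #T) ^ 2 ≤ #G * (#Fm * (m ^ ℓ) ^ c) ^ 2 := by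
    rw [card_sigma, sum_mul]
    refine sum_le_card_nsmul _ _ _ fun g hg => ?_
    obtain ⟨-, A, hAT, hA, j, hj⟩ := mem_filter.1 hg
    rw [Fintype.card_piFinset, Fin.prod_univ_two, sq, sq, mul_mul_mul_comm]
    exact Nat.mul_le_mul (card_solutions_mul_le hFm g (u 0) hA hAT hj)
      (card_solutions_mul_le hFm g (u 1) hA hAT hj)
  have h3 : #G * (ℓ ^ k) ^ c ≤ #Fl ^ c * (k ^ (2 * k)) ^ c := by
    calc #G * (ℓ ^ k) ^ c
        ≤ (∏ j, #{g ∈ Fl | #((W j).image g) ≤ k}) * (ℓ ^ k) ^ c := by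
          rw [← Fintype.card_piFinset]
          exact Nat.mul_le_mul_right _ (card_le_card (filter_subset _ _))
      _ = ∏ j, #{g ∈ Fl | #((W j).image g) ≤ k} * ℓ ^ k := by
          rw [prod_mul_distrib, prod_const, card_univ, Fintype.card_fin]
      _ ≤ ∏ _j : Fin c, #Fl * k ^ (2 * k) :=
          prod_le_prod' fun j _ => card_collision_mul_le hℓ hFl (hW j)
      _ = _ := by simp [mul_pow]
  calc #(hashEvent k Fm Fl T u W) * ((m ^ #T) ^ 2 * (ℓ ^ k) ^ c)
      = #(hashEvent k Fm Fl T u W) * (m ^ #T) ^ 2 * (ℓ ^ k) ^ c := by ring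
    _ ≤ #G * (#Fm * (m ^ ℓ) ^ c) ^ 2 * (ℓ ^ k) ^ c :=
        Nat.mul_le_mul_right _ ((Nat.mul_le_mul_right _ h1).trans h2)
    _ = #G * (ℓ ^ k) ^ c * (#Fm * (m ^ ℓ) ^ c) ^ 2 := by ring
    _ ≤ #Fl ^ c * (k ^ (2 * k)) ^ c * (#Fm * (m ^ ℓ) ^ c) ^ 2 := Nat.mul_le_mul_right _ h3
    _ = (#Fm * (m ^ ℓ) ^ c) ^ 2 * #Fl ^ c * (k ^ (2 * k)) ^ c := by ring
    _ ≤ _ := Nat.mul_le_mul_right _ (le_card_familyFinset Fm Fl)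

open Classical in
theorem leaflessBad_subset [Fintype U] [NeZero m] {k : ℕ} (hk : 1 ≤ k) (hc : 1 ≤ c)
    (S : Finset U) (Fm : Finset (U → Fin m)) (Fl : Finset (U → Fin ℓ)) :
    {w ∈ familyFinset c Fm Fl | w ∈ leaflessBadEvent k S} ⊆
      {T ∈ S.powerset | 2 * k ≤ #T}.biUnion fun T => (range 3).biUnion fun a =>
        (sparseMaps m T a (2 * (c * (2 * k))) ×ˢ
          sparseMaps m T (2 - a) (2 * (c * (2 * k)))).biUnion fun p =>
          (Fintype.piFinset fun _ : Fin c => powersetCard (2 * k) T).biUnion fun W =>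
            hashEvent k Fm Fl T ![p.1, p.2] W := by
  intro w hw
  obtain ⟨hwZ, T, hTS, hleaf, hbad⟩ := mem_filter.1 hw
  obtain ⟨h0, h1⟩ := hleaf.leafCount_eq_zero
  obtain ⟨A, hAT, hA, hL, hE, hE', hd, W, hW⟩ := exists_sparse_critical_subset hk hc w
    (w.hash 0) (w.hash 1) (T := T) (by omega) (le_of_lt hbad)
  -- Cutting off to zero outside `A` makes the union run over assignments on `A` only.
  have htrunc : ∀ h : U → Fin m, ∀ x ∈ A, h x = if x ∈ A then h x else 0 :=
    fun h x hx => (if_pos hx).symm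
  have hsparse : ∀ (h : U → Fin m) (a : ℕ), leafCount A h ≤ a →
      excess A h ≤ 2 * (c * (2 * k)) →
      (fun x => if x ∈ A then h x else 0) ∈ sparseMaps m A a (2 * (c * (2 * k))) := by
    intro h a hl he
    unfold leafCount at hl
    unfold excess at he
    rw [fiberSum_congr _ (htrunc h)] at hl he
    exact mem_sparseMaps.2 ⟨fun x hx => if_neg hx, hl, he⟩
  simp only [mem_biUnion, mem_filter, mem_powerset, mem_range, mem_product]
  refine ⟨A, ⟨hAT.trans hTS, hA⟩, leafCount A (w.hash 0), by omega, (_, _),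
    ⟨hsparse (w.hash 0) _ le_rfl hE, hsparse (w.hash 1) _ (by omega) hE'⟩, W,
    Fintype.mem_piFinset.2 fun j => (hW j).1, mem_hashEvent.2 ⟨hwZ, ?_, hd, fun j => (hW j).2⟩⟩
  intro i x hx
  fin_cases i
  · exact htrunc (w.hash 0) x hx
  · exact htrunc (w.hash 1) x hx

/-- The contribution of a single set of `t` keys to the union bound, up to constant factors. -/
noncomputable def termBound (m D t : ℕ) : ℝ :=
  if t = 0 then 0 else (t + 1 : ℝ) ^ D * ((m : ℝ) ^ (t + 1) * t.factorial) / ((m : ℝ) ^ t) ^ 2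

/-- The leaf budgets add up to two, so the half powers combine to `m^(t+1) * t!`, independently of
the split. -/
theorem sparseBound_mul_sparseBound (m t K : ℕ) {a : ℕ} (ha : a ≤ 2) :
    sparseBound m t a K * sparseBound m t (2 - a) K =
      (t + 1 : ℝ) ^ (4 + 4 * K) * ((m : ℝ) ^ (t + 1) * t.factorial) := by
  have hm : √(m : ℝ) ^ 2 = m := Real.sq_sqrt (by positivity)
  have hf : √(t.factorial : ℝ) ^ 2 = t.factorial := Real.sq_sqrt (by positivity)
  have h1 : 4 + 4 * K = 2 * (a + K) + 2 * (2 - a + K) := by omega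
  have h2 : 2 * (t + 1) = t + a + (t + (2 - a)) := by omega
  unfold sparseBound
  rw [← hf, ← hm, ← pow_mul, h1, h2, Real.sqrt_sq (by positivity), pow_add, pow_add √(m : ℝ)]
  rw [Real.sqrt_sq (by positivity)]
  ring

open Classical in
theorem card_leaflessBad_le [Fintype U] [NeZero m] {k : ℕ} (hk : 1 ≤ k) (hc : 1 ≤ c)
    (hℓ : 1 ≤ ℓ) (S : Finset U) {Fm : Finset (U → Fin m)} {Fl : Finset (U → Fin ℓ)}
    (hFm : IsWiseIndependent (2 * k) (Fm : Set (U → Fin m)))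
    (hFl : IsWiseIndependent (2 * k) (Fl : Set (U → Fin ℓ))) :
    (#{w ∈ familyFinset c Fm Fl | w ∈ leaflessBadEvent k S} : ℝ) ≤
      #(familyFinset c Fm Fl) * (3 * ((k : ℝ) ^ (2 * k)) ^ c / (ℓ : ℝ) ^ (c * k)) *
        ∑ t ∈ range (#S + 1), (#S).choose t *
          termBound m (4 + 4 * (2 * (c * (2 * k))) + 2 * k * c) t := by
  have hm0 : (0 : ℝ) < m := by exact_mod_cast Nat.pos_of_neZero m
  have hℓ0 : (0 : ℝ) < ℓ := by exact_mod_cast hℓ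
  set K := 2 * (c * (2 * k)) with hK
  set N : ℝ := (#(familyFinset c Fm Fl) : ℝ)
  have hterm : ∀ T ∈ {T ∈ S.powerset | 2 * k ≤ #T},
      (∑ a ∈ range 3, ∑ p ∈ sparseMaps m T a K ×ˢ sparseMaps m T (2 - a) K,
        ∑ W ∈ Fintype.piFinset fun _ : Fin c => powersetCard (2 * k) T,
          (#(hashEvent k Fm Fl T ![p.1, p.2] W) : ℝ)) ≤
      N * (3 * ((k : ℝ) ^ (2 * k)) ^ c / (ℓ : ℝ) ^ (c * k)) *
        termBound m (4 + 4 * K + 2 * k * c) #T := by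
    intro T hT
    have hT := (mem_filter.1 hT).2
    set q : ℝ := N * ((k : ℝ) ^ (2 * k)) ^ c / (((m : ℝ) ^ #T) ^ 2 * (ℓ : ℝ) ^ (c * k)) with hq
    have hq0 : 0 ≤ q := by positivity
    have hev : ∀ (u : Fin 2 → U → Fin m),
        ∀ W ∈ Fintype.piFinset fun _ : Fin c => powersetCard (2 * k) T,
        (#(hashEvent k Fm Fl T u W) : ℝ) ≤ q := by
      intro u W hW
      rw [hq, le_div_iff₀ (by positivity), mul_comm c k, pow_mul]
      change _ ≤ (#(familyFinset c Fm Fl) : ℝ) * _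
      exact_mod_cast card_hashEvent_mul_le hc hℓ hFm hFl hT u fun j =>
        (mem_powersetCard.1 (Fintype.mem_piFinset.1 hW j)).2
    have hWcard : (#(Fintype.piFinset fun _ : Fin c => powersetCard (2 * k) T) : ℝ) ≤
        (#T + 1 : ℝ) ^ (2 * k * c) := by
      rw [Fintype.card_piFinset, prod_const, card_univ, Fintype.card_fin, card_powersetCard,
        pow_mul]
      exact_mod_cast Nat.pow_le_pow_left ((Nat.choose_le_pow _ _).trans
        (Nat.pow_le_pow_left (Nat.le_succ _) _)) c
    have hpair : ∀ a ∈ range 3, (#(sparseMaps m T a K ×ˢ sparseMaps m T (2 - a) K) : ℝ) ≤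
        (#T + 1 : ℝ) ^ (4 + 4 * K) * ((m : ℝ) ^ (#T + 1) * (#T).factorial) := by
      intro a ha
      rw [← sparseBound_mul_sparseBound m #T K (Nat.le_of_lt_succ (mem_range.1 ha)), card_product,
        Nat.cast_mul]
      exact mul_le_mul (card_sparseMaps_le T a K) (card_sparseMaps_le T (2 - a) K)
        (by positivity) (by unfold sparseBound; positivity)
    calc _ ≤ ∑ a ∈ range 3, ∑ p ∈ sparseMaps m T a K ×ˢ sparseMaps m T (2 - a) K,
          (#T + 1 : ℝ) ^ (2 * k * c) * q := by
          refine sum_le_sum fun a _ => sum_le_sum fun p _ => ?_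
          refine (sum_le_card_nsmul _ _ q (hev _)).trans ?_
          rw [nsmul_eq_mul]
          gcongr
      _ ≤ ∑ a ∈ range 3, ((#T + 1 : ℝ) ^ (4 + 4 * K) * ((m : ℝ) ^ (#T + 1) * (#T).factorial)) *
          ((#T + 1 : ℝ) ^ (2 * k * c) * q) := by
          refine sum_le_sum fun a ha => ?_
          rw [sum_const, nsmul_eq_mul]
          gcongr
          exact hpair a ha
      _ = _ := by
          rw [sum_const, card_range, hq, termBound, if_neg (by omega), nsmul_eq_mul]
          push_cast
          field_simp
          ring
  calc (#{w ∈ familyFinset c Fm Fl | w ∈ leaflessBadEvent k S} : ℝ)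
      ≤ ∑ T ∈ S.powerset with 2 * k ≤ #T, ∑ a ∈ range 3,
        ∑ p ∈ sparseMaps m T a K ×ˢ sparseMaps m T (2 - a) K,
        ∑ W ∈ Fintype.piFinset fun _ : Fin c => powersetCard (2 * k) T,
          (#(hashEvent k Fm Fl T ![p.1, p.2] W) : ℝ) := by
        have h := (card_le_card (leaflessBad_subset hk hc S Fm Fl)).trans <|
          card_biUnion_le.trans <| sum_le_sum fun T _ => card_biUnion_le.trans <|
            sum_le_sum fun a _ => card_biUnion_le.trans <| sum_le_sum fun p _ => card_biUnion_le
        exact_mod_cast h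
    _ ≤ ∑ T ∈ S.powerset with 2 * k ≤ #T, N * (3 * ((k : ℝ) ^ (2 * k)) ^ c / (ℓ : ℝ) ^ (c * k)) *
        termBound m (4 + 4 * K + 2 * k * c) #T := sum_le_sum hterm
    _ ≤ ∑ T ∈ S.powerset, N * (3 * ((k : ℝ) ^ (2 * k)) ^ c / (ℓ : ℝ) ^ (c * k)) *
        termBound m (4 + 4 * K + 2 * k * c) #T := by
        refine sum_le_sum_of_subset_of_nonneg (filter_subset _ _) fun T _ _ => ?_
        unfold termBound
        split_ifs <;> positivity
    _ = _ := by
        rw [← mul_sum, sum_powerset_apply_card (fun t => termBound m (4 + 4 * K + 2 * k * c) t)]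
        simp only [nsmul_eq_mul]

theorem sum_choose_mul_termBound_le {ε : ℝ} (hε : 0 < ε) (D : ℕ) {n m : ℕ} [NeZero m]
    (hnm : (1 + ε) * (n : ℝ) ≤ m) :
    ∑ t ∈ range (n + 1), (n.choose t : ℝ) * termBound m D t ≤
      n * ∑' s : ℕ, (s + 2 : ℝ) ^ D * (1 / (1 + ε)) ^ s := by
  have hm0 : (0 : ℝ) < m := by exact_mod_cast Nat.pos_of_neZero m
  set ρ : ℝ := 1 / (1 + ε) with hρ
  have hρ0 : 0 < ρ := by positivity
  have hρ1 : ρ < 1 := by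
    rw [hρ, div_lt_one (by positivity)]
    linarith
  have hnρ : (n : ℝ) / m ≤ ρ := by
    rw [hρ, div_le_div_iff₀ hm0 (by positivity)]
    linarith
  have hsum : Summable fun s : ℕ => (s + 2 : ℝ) ^ D * ρ ^ s := by
    have h1 := summable_pow_mul_geometric_of_norm_lt_one D (r := ρ)
      (by rwa [Real.norm_of_nonneg hρ0.le])
    have h2 := ((summable_nat_add_iff 2).2 h1).mul_right (ρ ^ 2)⁻¹
    refine h2.congr fun s => ?_
    push_cast
    rw [pow_add]
    field_simp
  rw [sum_range_succ']
  -- Only sets of at least `2k` keys occur, which justifies the value zero here. The general formula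
  -- would give `m` at `t = 0`, not bounded by a multiple of `n`.
  have h0 : (n.choose 0 : ℝ) * termBound m D 0 = 0 := by simp [termBound]
  rw [h0, add_zero]
  calc _ ≤ ∑ s ∈ range n, (n : ℝ) * ((s + 2 : ℝ) ^ D * ρ ^ s) := by
        refine sum_le_sum fun s _ => ?_
        have hch : (n.choose (s + 1) : ℝ) * (s + 1).factorial ≤ (n : ℝ) ^ (s + 1) := by
          rw [← le_div_iff₀ (by positivity)]
          exact Nat.choose_le_pow_div (s + 1) n
        calc (n.choose (s + 1) : ℝ) * termBound m D (s + 1)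
            = (n.choose (s + 1) * (s + 1).factorial : ℝ) * ((s + 2 : ℝ) ^ D / (m : ℝ) ^ s) := by
              rw [termBound, if_neg (Nat.succ_ne_zero s)]
              push_cast
              rw [show (s + 1 + 1 : ℝ) = s + 2 by ring]
              field_simp
              ring
          _ ≤ (n : ℝ) ^ (s + 1) * ((s + 2 : ℝ) ^ D / (m : ℝ) ^ s) := by gcongr
          _ = n * ((s + 2 : ℝ) ^ D * ((n : ℝ) / m) ^ s) := by
              rw [div_pow]
              ring
          _ ≤ _ := by gcongr
    _ = n * ∑ s ∈ range n, (s + 2 : ℝ) ^ D * ρ ^ s := by rw [mul_sum]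
    _ ≤ _ := by
        gcongr
        exact hsum.sum_le_tsum _ fun s _ => by positivity

end UnionBound
end CuckooHash

open CuckooHash Finset in
theorem lemma5 (ε : ℝ) (hε : 0 < ε) (k c : ℕ) (hk : 1 ≤ k) (hc : 1 ≤ c) :
    ∃ C : ℝ, 0 < C ∧
      ∀ (U : Type*) [Finite U] (n m ℓ : ℕ) [NeZero m] (S : Finset U)
        (Hm : Set (U → Fin m)) (Hl : Set (U → Fin ℓ)),
        1 ≤ ℓ →
        (1 + ε) * (n : ℝ) ≤ (m : ℝ) →
        S.card = n →
        CuckooHash.IsWiseIndependent (2 * k) Hm →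
        CuckooHash.IsWiseIndependent (2 * k) Hl →
        CuckooHash.uniformProb (CuckooHash.familyZ c Hm Hl)
            (CuckooHash.leaflessBadEvent k S) ≤
          C * ((n : ℝ) / (ℓ : ℝ) ^ (c * k)) := by
  classical
  set B : ℝ := ∑' s : ℕ, (s + 2 : ℝ) ^ (4 + 4 * (2 * (c * (2 * k))) + 2 * k * c) *
    (1 / (1 + ε)) ^ s with hB
  have hB0 : 0 ≤ B := tsum_nonneg fun s => by positivity
  -- The added 1 secures positivity, since only `0 ≤ B` has been shown.
  refine ⟨3 * ((k : ℝ) ^ (2 * k)) ^ c * B + 1, by positivity, ?_⟩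
  intro U _ n m ℓ _ S Hm Hl hℓ hnm hS hHm hHl
  subst hS
  have := Fintype.ofFinite U
  have := Fintype.ofFinite (HashPair U m ℓ c)
  obtain ⟨Fm, rfl⟩ := Hm.toFinite.exists_finset_coe
  obtain ⟨Fl, rfl⟩ := Hl.toFinite.exists_finset_coe
  have h1 := card_leaflessBad_le hk hc hℓ S hHm hHl
  have h2 := sum_choose_mul_termBound_le hε (4 + 4 * (2 * (c * (2 * k))) + 2 * k * c) hnm
  rw [← hB] at h2
  rw [uniformProb, ← coe_familyFinset, Set.ncard_coe_finset,
    show (familyFinset c Fm Fl : Set (HashPair U m ℓ c)) ∩ leaflessBadEvent k S =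
      (({w ∈ familyFinset c Fm Fl | w ∈ leaflessBadEvent k S} : Finset (HashPair U m ℓ c)) :
        Set (HashPair U m ℓ c)) by ext w; simp, Set.ncard_coe_finset]
  refine div_le_of_le_mul₀ (by positivity) (by positivity) (h1.trans ?_)
  calc _ ≤ (#(familyFinset c Fm Fl) : ℝ) * (3 * ((k : ℝ) ^ (2 * k)) ^ c / (ℓ : ℝ) ^ (c * k)) *
        (#S * B) := by gcongr
    _ = 3 * ((k : ℝ) ^ (2 * k)) ^ c * B * (#S / (ℓ : ℝ) ^ (c * k)) *
        #(familyFinset c Fm Fl) := by ring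
    _ ≤ _ := by
        gcongr
        linarith
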